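/- Let $b,c\ge 0$ be integers and let $q_1,\dots,q_c\in(0,1)$. A plane partition is a matrix $\pi=(\pi_{ij})_{i,j\ge1}$ of nonnegative integers with finitely many nonzero entries such that $\pi_{ij}\ge\pi_{i+1,j}$ and $\pi_{ij}\ge\pi_{i,j+1}$ for all $i,j$. Its shape is the Young diagram $\{(i,j):\pi_{ij}>0\}$, whose row lengths form a partition $\lambda=(\lambda_1\ge\lambda_2\ge\cdots)$, and its descent set is $\mathrm{Des}(\pi)=\{(i,j):\pi_{ij}>\pi_{i+1,j}\}$. Let $\mathrm{PP}(\infty,b,c)$ be the set of plane partitions with at most $b$ nonzero rows and all entries at most $c$. The $g$-measure is the probability measure on $\mathrm{PP}(\infty,b,c)$ given by $$\mathrm P_{g,b,c}(\pi)=\frac1{Z_{b,c}}\prod_{(i,j)\in\mathrm{Des}(\pi)}q_{\pi_{ij}},\qquad Z_{b,c}=\sum_{\pi\in\mathrm{PP}(\infty,b,c)}\ \prod_{(i,j)\in\mathrm{Des}(\pi)}q_{\pi_{ij}}.$$ Then the sum defining $Z_{b,c}$ converges, $Z_{b,c}=\prod_{i=1}^c(1-q_i)^{-b}$ (so that $\mathrm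 P_{g,b,c}$ is indeed a probability measure), and for every integer $a\ge0$ $$\mathrm P_{g,b,c}(\lambda_1\le a)=\frac1{Z_{b,c}}\,s_{(a^b)}(\underbrace{1,\dots,1}_{b},q_1,\dots,q_c),$$ where $s_{(a^b)}$ is the Schur polynomial, in $b+c$ variables, of the rectangular partition with $b$ parts equal to $a$. Moreover, for every integer $a\ge0$, $$\mathrm P_{g,b,c}(\lambda_1\le a)=\frac1{Z_{b,c}}\det\left[\hat\varphi_{i-j}\right]_{i,j=1}^a,\qquad \hat\varphi_k=\sum_{\ell\ge0}\binom{b}{\ell+k}e_\ell(q_1,\dots,q_c)\quad(k\in\mathbb Z),$$ where $e_\ell$ is the $\ell$-th elementary symmetric polynomial and $\binom{b}{m}=0$ for $m<0$; equivalently, for every complex $z\neq0$, $$\sum_{k\in\mathbb Z}\hat\varphi_k z^k=(1+z)^b\prod_{i=1}^c(1+q_iz^{-1}).$$ -/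

import Mathlib

open MeasureTheory
open scoped ENNReal

noncomputable section

/-- A plane partition: a matrix of natural numbers with finitely many nonzero entries that is weakly
decreasing along rows and down columns. Rows and columns are indexed from `0`. -/
@[ext]
structure PlanePartition where
  entry : ℕ → ℕ → ℕ
  col_le : ∀ i j, entry (i + 1) j ≤ entry i j
  row_le : ∀ i j, entry i (j + 1) ≤ entry i j
  finite_support : {p : ℕ × ℕ | 0 < entry p.1 p.2}.Finite

namespace PlanePartition

/-- The shape `sh(π) = {(i,j) : π_{ij} > 0}`, as a Young diagram. -/
def shape (π : PlanePartition) : YoungDiagram where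
  cells := π.finite_support.toFinset
  isLowerSet := by
    rintro ⟨i, j⟩ ⟨i', j'⟩ ⟨hi, hj⟩ h
    simp only [Set.Finite.coe_toFinset, Set.mem_ofPred_eq] at h ⊢
    have h1 : π.entry i j ≤ π.entry i' j :=
      antitone_nat_of_succ_le (f := fun k => π.entry k j) (fun k => π.col_le k j) hi
    have h2 : π.entry i' j ≤ π.entry i' j' :=
      antitone_nat_of_succ_le (f := fun k => π.entry i' k) (fun k => π.row_le i' k) hj
    exact h.trans_le (h1.trans h2)

/-- The descent set `Des(π) = {(i,j) : π_{ij} > π_{i+1,j}}`; such cells lie in the shape. -/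
def des (π : PlanePartition) : Finset (ℕ × ℕ) :=
  π.shape.cells.filter fun p => π.entry (p.1 + 1) p.2 < π.entry p.1 p.2

theorem mem_des (π : PlanePartition) (p : ℕ × ℕ) :
    p ∈ π.des ↔ π.entry (p.1 + 1) p.2 < π.entry p.1 p.2 := by
  simp only [des, shape, Finset.mem_filter, Set.Finite.mem_toFinset, Set.mem_ofPred_eq,
    and_iff_right_iff_imp]
  omega

/-- The length `λ₁` of the first row of the shape `λ` of `π`. -/
def lambda1 (π : PlanePartition) : ℕ := π.shape.rowLen 0

end PlanePartition

/-- `PP(∞, b, c)`: plane partitions with at most `b` rows and all entries at most `c`. -/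
@[ext]
structure PP (b c : ℕ) extends PlanePartition where
  rows_le : toPlanePartition.shape.colLen 0 ≤ b
  entry_le : ∀ i j, entry i j ≤ c

/-- `PP(∞, b, c)` is a discrete space: all subsets are measurable. -/
instance (b c : ℕ) : MeasurableSpace (PP b c) := ⊤

/-- The entry of `π` at a descent, an element of `{1, …, c}`, as the (`0`-based) index of the
corresponding parameter among `q_1, …, q_c`. -/
def PP.level {b c : ℕ} (π : PP b c) (p : π.des) : Fin c :=
  ⟨π.entry p.1.1 p.1.2 - 1, by
    have h1 := (π.mem_des p.1).1 p.2
    have h2 := π.entry_le p.1.1 p.1.2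
    omega⟩

/-- The unnormalized weight `∏_{(i,j) ∈ Des(π)} q_{π_{ij}}`. -/
def gWeight (b : ℕ) {c : ℕ} (q : Fin c → ℝ) (π : PP b c) : ℝ :=
  ∏ p : π.des, q (π.level p)

/-- The normalization constant `Z_{b,c}`. -/
def gZ (b : ℕ) {c : ℕ} (q : Fin c → ℝ) : ℝ := ∑' π : PP b c, gWeight b q π

/-- The `g`-measure: `π` has mass `Z_{b,c}⁻¹ ∏_{(i,j) ∈ Des(π)} q_{π_{ij}}`. -/
def gMeasure (b : ℕ) {c : ℕ} (q : Fin c → ℝ) : Measure (PP b c) :=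
  Measure.sum fun π => ENNReal.ofReal (gWeight b q π / gZ b q) • Measure.dirac π

/-- Semistandard Young tableaux of shape `μ` with entries in `{0, …, n - 1}`. -/
abbrev BoundedSSYT (μ : YoungDiagram) (n : ℕ) : Type :=
  {T : SemistandardYoungTableau μ // ∀ p ∈ μ.cells, T p.1 p.2 < n}

instance (μ : YoungDiagram) (n : ℕ) : Finite (BoundedSSYT μ n) := by
  refine Finite.of_injective
    (fun (T : BoundedSSYT μ n) (p : μ.cells) => (⟨T.1 p.1.1 p.1.2, T.2 p.1 p.2⟩ : Fin n)) ?_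
  intro T T' h
  apply Subtype.ext
  apply SemistandardYoungTableau.ext
  intro i j
  by_cases hij : (i, j) ∈ μ
  · have := congrFun h ⟨(i, j), (YoungDiagram.mem_cells _).2 hij⟩
    simpa using this
  · rw [T.1.zeros hij, T'.1.zeros hij]

instance (μ : YoungDiagram) (n : ℕ) : Fintype (BoundedSSYT μ n) := Fintype.ofFinite _

/-- The Schur polynomial `s_μ(x_0, …, x_{n-1})`. -/
def schurPoly (μ : YoungDiagram) (n : ℕ) : MvPolynomial (Fin n) ℝ :=
  ∑ T : BoundedSSYT μ n, ∏ p : μ.cells, MvPolynomial.X ⟨T.1 p.1.1 p.1.2, T.2 p.1 p.2⟩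

/-- The rectangular partition `(a^b)`: `b` rows of length `a`. -/
def rectDiagram (a b : ℕ) : YoungDiagram where
  cells := Finset.range b ×ˢ Finset.range a
  isLowerSet := by
    rintro ⟨i, j⟩ ⟨i', j'⟩ ⟨hi, hj⟩ h
    simp only [Finset.coe_product, Finset.coe_range, Set.mem_prod, Set.mem_Iio] at h hi hj ⊢
    omega

/-- The binomial coefficient `b.choose m` for an integer `m`; it vanishes for negative `m`. -/
def intChoose (b : ℕ) (m : ℤ) : ℕ := if 0 ≤ m then b.choose m.toNat else 0

/-- `φ̂_k = ∑_{ℓ ≥ 0} (b choose ℓ + k) e_ℓ(q_1, …, q_c)`; the terms with `ℓ > c` vanish. -/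
def phiHat (b : ℕ) {c : ℕ} (q : Fin c → ℝ) (k : ℤ) : ℝ :=
  ∑ l ∈ Finset.range (c + 1),
    (intChoose b (l + k) : ℝ) * MvPolynomial.eval q (MvPolynomial.esymm (Fin c) ℝ l)

end

/-!
Cut a plane partition `π` into the layers `{(i, j) : π i j > k}`. When `λ₁ ≤ a`, the column lengths
of the layers form a decreasing chain of partitions in an `a × b` box, and the weight of `π` is a
product over consecutive layers of one-step transfer weights. Applied to a determinant whose rows
depend only on the individual parts, such a transfer step acts row by row, up to a multiple of the
next row that the determinant does not see; on Jacobi–Trudi determinants it multiplies the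
generating function by `1 + q X`. Hence the total weight of `{λ₁ ≤ a}` is the Toeplitz determinant
with generating function `(1 + X) ^ b * ∏ i, (1 + q i X)`. Reading a semistandard tableau of
rectangular shape as a column-strict plane partition, the same computation, now with the transfer
weights of strips, gives the dual Jacobi–Trudi formula for its Schur polynomial, in which a variable
equal to `1` contributes a factor `1 + X`.

For the normalization, count the descents of `π` by row and value. The resulting `b × c` array is
arbitrary and `π` is recovered from it by last passage percolation, so the sum of the weights
factors into geometric series.
-/

/-! ### Transfer operators on partitions and alternating forms -/

section AlternatingForms

open Finset
open Matrix (vecCons vecHead vecTail cons_head_tail)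

/-- The partitions `m` with at most `a` parts whose diagram is contained in that of `l`, written as
weakly decreasing vectors. -/
noncomputable def partitionsBelow {a : ℕ} (l : Fin a → ℕ) : Finset (Fin a → ℕ) :=
  open Classical in {m ∈ Iic l | Antitone m}

theorem mem_partitionsBelow {a : ℕ} {l m : Fin a → ℕ} :
    m ∈ partitionsBelow l ↔ m ≤ l ∧ Antitone m := by
  simp [partitionsBelow]

theorem antitone_vecCons_iff_sup_le {a : ℕ} {t : ℕ} {m : Fin a → ℕ} :
    Antitone (vecCons t m) ↔ univ.sup m ≤ t ∧ Antitone m := by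
  cases a with
  | zero => simp [Subsingleton.antitone]
  | succ a =>
    refine antitone_vecCons.trans (and_congr_left fun hm => ?_)
    rw [Finset.sup_le_iff]
    exact ⟨fun h i _ => (hm (Fin.zero_le i)).trans h, fun h => h 0 (mem_univ 0)⟩

theorem sum_partitionsBelow_succ {a : ℕ} {M : Type*} [AddCommMonoid M] (l : Fin (a + 1) → ℕ)
    (g : (Fin (a + 1) → ℕ) → M) :
    ∑ m ∈ partitionsBelow l, g m =
      ∑ m ∈ partitionsBelow (vecTail l), ∑ t ∈ Icc (univ.sup m) (l 0), g (vecCons t m) := by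
  rw [sum_sigma']
  refine sum_nbij' (fun m => ⟨vecTail m, vecHead m⟩) (fun p => vecCons p.2 p.1) ?_ ?_
    (fun m _ => cons_head_tail m) (fun p _ => by simp) fun m _ => by rw [cons_head_tail]
  · intro m hm
    rw [mem_partitionsBelow, ← cons_head_tail m, antitone_vecCons_iff_sup_le] at hm
    simp only [mem_sigma, mem_partitionsBelow, mem_Icc]
    exact ⟨⟨fun i => hm.1 i.succ, hm.2.2⟩, hm.2.1, hm.1 0⟩
  · rintro ⟨m, t⟩ h
    simp only [mem_sigma, mem_partitionsBelow, mem_Icc] at h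
    rw [mem_partitionsBelow, antitone_vecCons_iff_sup_le]
    exact ⟨Fin.cases h.2.2 h.1.1, h.2.1, h.1.2⟩

variable {R V W : Type*} [CommRing R] [AddCommGroup V] [Module R V] [AddCommGroup W] [Module R W]

theorem curryLeft_sum_smul {a : ℕ} (f : V [⋀^Fin (a + 1)]→ₗ[R] W) {ι : Type*} (s : Finset ι)
    (c : ι → R) (y : ι → V) (w : Fin a → V) :
    f.curryLeft (∑ t ∈ s, c t • y t) w = ∑ t ∈ s, c t • f (vecCons (y t) w) := by
  change f.toMultilinearMap.curryLeft _ w = _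
  simp only [map_sum, map_smul, _root_.sum_apply, smul_apply]
  rfl

theorem curryLeft_sup_eq_zero {a : ℕ} (f : V [⋀^Fin (a + 1)]→ₗ[R] W) {v : ℕ → ℕ → V}
    (hv : v a 0 = 0) {m : Fin a → ℕ} (hm : Antitone m) :
    f.curryLeft (v 0 (univ.sup m)) (fun i => v i (m i)) = 0 := by
  rw [AlternatingMap.curryLeft_apply_apply]
  cases a with
  | zero => exact f.map_coord_zero 0 (by simpa using hv)
  | succ a =>
    have hsup : univ.sup m = m 0 :=
      le_antisymm (Finset.sup_le fun i _ => hm (Fin.zero_le i)) (le_sup (mem_univ 0))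
    exact f.map_eq_zero_of_eq _ (i := 0) (j := 1) (by simp [hsup]) (by simp)

/-- The boundary term at `s` left by the summation over the `k`-th part is proportional to the row
`v (k + 1) s`, and `s` is the next part: an alternating form does not see it. -/
theorem sum_partitionsBelow_prod_smul {a : ℕ} {κ : ℕ → ℕ → R} {v v' : ℕ → ℕ → V}
    (hκ : ∀ k s l, s ≤ l → ∃ γ : R, ∑ t ∈ Icc s l, κ l t • v k t = v' k l + γ • v (k + 1) s)
    (hv : v a 0 = 0) (f : V [⋀^Fin a]→ₗ[R] W) {l : Fin a → ℕ} (hl : Antitone l) :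
    ∑ m ∈ partitionsBelow l, (∏ i, κ (l i) (m i)) • f (fun i => v i (m i)) =
      f fun i => v' i (l i) := by
  induction a generalizing v v' with
  | zero =>
    have h : partitionsBelow l = {l} := by
      ext m
      simp [mem_partitionsBelow, Subsingleton.elim m l, hl]
    simp only [h, sum_singleton, Fin.prod_univ_zero, one_smul]
    exact congrArg f (Subsingleton.elim _ _)
  | succ a ih =>
    obtain ⟨hl₀, hl⟩ : univ.sup (vecTail l) ≤ l 0 ∧ Antitone (vecTail l) := by
      rwa [← cons_head_tail l, antitone_vecCons_iff_sup_le] at hl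
    have sum_first_row : ∀ m ∈ partitionsBelow (vecTail l),
        ∑ t ∈ Icc (univ.sup m) (l 0), (∏ i, κ (l i) (vecCons t m i)) •
            f (fun i => v i (vecCons t m i)) =
          (∏ i, κ (vecTail l i) (m i)) • f.curryLeft (v' 0 (l 0)) (fun i => v (i + 1) (m i)) := by
      intro m hm
      obtain ⟨hml, hm⟩ := mem_partitionsBelow.1 hm
      obtain ⟨γ, hγ⟩ := hκ 0 _ _ ((Finset.sup_mono_fun fun i _ => hml i).trans hl₀)
      have telescoped := congrArg (fun y => f.curryLeft y fun i => v (i + 1) (m i)) hγ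
      simp only [curryLeft_sum_smul, zero_add, map_add, map_smul, AlternatingMap.add_apply,
        AlternatingMap.smul_apply,
        curryLeft_sup_eq_zero f (v := fun k => v (k + 1)) hv hm, smul_zero, add_zero] at telescoped
      rw [← telescoped, smul_sum]
      refine sum_congr rfl fun t _ => ?_
      have rows : (fun i : Fin (a + 1) => v i (vecCons t m i)) =
          vecCons (v 0 t) fun i => v (i + 1) (m i) := by
        funext i
        cases i using Fin.cases <;> rfl
      rw [rows, Fin.prod_univ_succ, mul_comm, mul_smul]
      rfl
    rw [sum_partitionsBelow_succ, sum_congr rfl sum_first_row,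
      ih (fun k => hκ (k + 1)) hv (f.curryLeft (v' 0 (l 0))) hl,
      AlternatingMap.curryLeft_apply_apply]
    congr 1
    funext i
    cases i using Fin.cases <;> rfl

end AlternatingForms

/-! ### Chains of partitions in a box -/

section Chains

open Finset

/-- The partitions whose diagram fits into an `a × b` box: at most `a` parts, each at most `b`. -/
abbrev BoxPartition (a b : ℕ) : Type := partitionsBelow fun _ : Fin a => b

namespace BoxPartition

variable {a b : ℕ} (l : BoxPartition a b)

theorem antitone : Antitone l.1 := (mem_partitionsBelow.1 l.2).2

theorem apply_le (i : Fin a) : l.1 i ≤ b := (mem_partitionsBelow.1 l.2).1 i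

/-- The full box, as a partition. -/
noncomputable def full (a b : ℕ) : BoxPartition a b :=
  ⟨fun _ => b, mem_partitionsBelow.2 ⟨le_rfl, antitone_const⟩⟩

theorem eq_full_iff : l = full a b ↔ ∀ i, l.1 i = b := by
  rw [Subtype.ext_iff, funext_iff]
  rfl

end BoxPartition

/-- The weight of a step from a partition `l` to a partition `m` contained in it: the product of the
weights `κ lᵢ mᵢ` of the parts. -/
noncomputable def stepWeight {a : ℕ} {R : Type*} [CommSemiring R] (κ : ℕ → ℕ → R)
    (l m : Fin a → ℕ) : R :=
  open Classical in if m ≤ l then ∏ i, κ (l i) (m i) else 0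

theorem sum_stepWeight_smul {a b : ℕ} {R W : Type*} [CommSemiring R] [AddCommMonoid W] [Module R W]
    (κ : ℕ → ℕ → R) (l : BoxPartition a b) (g : (Fin a → ℕ) → W) :
    ∑ m : BoxPartition a b, stepWeight κ l.1 m.1 • g m.1 =
      ∑ m ∈ partitionsBelow l.1, (∏ i, κ (l.1 i) (m i)) • g m := by
  classical
  have below_box : partitionsBelow l.1 = {m ∈ partitionsBelow fun _ => b | m ≤ l.1} := by
    ext m
    simp only [mem_partitionsBelow, mem_filter]
    exact ⟨fun h => ⟨⟨h.1.trans l.apply_le, h.2⟩, h.1⟩, fun h => ⟨h.2, h.1.2⟩⟩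
  rw [sum_coe_sort _ fun m => stepWeight κ l.1 m • g m, below_box, sum_filter]
  exact sum_congr rfl fun m _ => by simp only [stepWeight, ite_smul, zero_smul]

theorem sum_stepWeight_smul_alternating {a b : ℕ} {R V W : Type*} [CommRing R] [AddCommGroup V]
    [Module R V] [AddCommGroup W] [Module R W] {κ : ℕ → ℕ → R} {v v' : ℕ → ℕ → V}
    (hκ : ∀ k s l, s ≤ l → ∃ γ : R, ∑ t ∈ Icc s l, κ l t • v k t = v' k l + γ • v (k + 1) s)
    (hv : v a 0 = 0) (f : V [⋀^Fin a]→ₗ[R] W) (l : BoxPartition a b) :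
    ∑ m : BoxPartition a b, stepWeight κ l.1 m.1 • f (fun i => v i (m.1 i)) =
      f fun i => v' i (l.1 i) := by
  rw [sum_stepWeight_smul κ l fun m => f fun i => v i (m i)]
  exact sum_partitionsBelow_prod_smul hκ hv f l.antitone

/-- If the transfer operator with matrix `w k` maps `G P` to `G (P * y k)`, then a sum over chains
`M 0, …, M n` weighted by a product of such matrices evaluates by peeling off the operators. -/
theorem sum_chain {S A R : Type*} [Fintype S] [CommMonoid A] [CommSemiring R] (G : A → S → R)
    {n : ℕ} {w : Fin n → S → S → R} {y : Fin n → A}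
    (hw : ∀ k P l, ∑ m, w k l m * G P m = G (P * y k) l) (u : S → R) (P : A) :
    ∑ M : Fin (n + 1) → S,
        u (M 0) * (∏ k, w k (M k.castSucc) (M k.succ)) * G P (M (Fin.last n)) =
      ∑ l, u l * G (P * ∏ k, y k) l := by
  induction n generalizing u with
  | zero =>
    rw [← (Equiv.funUnique (Fin 1) S).symm.sum_comp]
    simp
  | succ n ih =>
    rw [← (Fin.consEquiv fun _ => S).sum_comp, Fintype.sum_prod_type]
    refine sum_congr rfl fun l _ => ?_
    have tail := ih (fun k => hw k.succ) (w 0 l)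
    rw [hw 0, mul_assoc, mul_comm _ (y 0), ← Fin.prod_univ_succ] at tail
    rw [← tail, mul_sum]
    refine sum_congr rfl fun M _ => ?_
    simp only [Fin.consEquiv_apply, Fin.prod_univ_succ (n := n), Fin.cons_zero, Fin.castSucc_zero,
      Fin.cons_succ, ← Fin.succ_castSucc, ← Fin.succ_last]
    ring

end Chains

/-! ### Jacobi–Trudi determinants -/

section JacobiTrudi

open Finset PowerSeries

variable {R : Type*} [CommRing R]

/-- The `i`-th row of a dual Jacobi–Trudi determinant with generating function `P`, for a partition
whose `i`-th part is `l`: its `j`-th entry is the coefficient of `P` at `l + j - i`, where the power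
of `X` takes care of negative indices. -/
noncomputable def jacobiTrudiRow (a i l : ℕ) : R⟦X⟧ →ₗ[R] (Fin a → R) :=
  LinearMap.pi fun j => (coeff (l + j)).comp (LinearMap.mulLeft R (X ^ i))

@[simp]
theorem jacobiTrudiRow_apply (a i l : ℕ) (P : R⟦X⟧) (j : Fin a) :
    jacobiTrudiRow a i l P j = coeff (l + j) (X ^ i * P) := rfl

theorem jacobiTrudiRow_X_mul (a i l : ℕ) (P : R⟦X⟧) :
    jacobiTrudiRow a i l (X * P) = jacobiTrudiRow a (i + 1) l P := by
  funext j
  simp only [jacobiTrudiRow_apply, pow_succ, mul_assoc]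

theorem jacobiTrudiRow_succ_succ (a i l : ℕ) (P : R⟦X⟧) :
    jacobiTrudiRow a (i + 1) (l + 1) P = jacobiTrudiRow a i l P := by
  funext j
  rw [jacobiTrudiRow_apply, jacobiTrudiRow_apply, pow_succ', mul_assoc, Nat.add_right_comm,
    coeff_succ_X_mul]

theorem jacobiTrudiRow_self_zero (a : ℕ) (P : R⟦X⟧) : jacobiTrudiRow a a 0 P = 0 := by
  funext j
  simp [coeff_X_pow_mul', j.2]

theorem jacobiTrudiRow_mul_one_add_smul_X (a i l : ℕ) (x : R) (P : R⟦X⟧) :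
    jacobiTrudiRow a i l (P * (1 + x • X)) =
      jacobiTrudiRow a i l P + x • jacobiTrudiRow a (i + 1) l P := by
  rw [mul_add, mul_one, mul_smul_comm, map_add, map_smul, mul_comm, jacobiTrudiRow_X_mul]

/-- The dual Jacobi–Trudi determinant `det [coeff (lᵢ + j - i) (P * D lᵢ)]` of a partition `l`. The
generating function `P * D lᵢ` may depend on the part: `D t = 1` gives Schur functions, and
`D t = (1 + X) ^ t` gives dual Grothendieck polynomials. -/
noncomputable def jacobiTrudiDet {a : ℕ} (D : ℕ → R⟦X⟧) (P : R⟦X⟧) (l : Fin a → ℕ) : R :=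
  Matrix.det fun i : Fin a => jacobiTrudiRow a i (l i) (P * D (l i))

/-- A kernel whose transfer operator multiplies the generating function `P` of the rows by
`1 + x X`, up to multiples of the next row at the lower end of the summation. -/
def IsTransferKernel (D : ℕ → R⟦X⟧) (κ : ℕ → ℕ → R) (x : R) : Prop :=
  ∀ (P : R⟦X⟧) (a i s l : ℕ), s ≤ l → ∃ γ : R,
    ∑ t ∈ Icc s l, κ l t • jacobiTrudiRow a i t (P * D t) =
      jacobiTrudiRow a i l (P * (1 + x • X) * D l) + γ • jacobiTrudiRow a (i + 1) s (P * D s)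

theorem sum_stepWeight_mul_jacobiTrudiDet {D : ℕ → R⟦X⟧} {κ : ℕ → ℕ → R} {x : R}
    (hκ : IsTransferKernel D κ x) (P : R⟦X⟧) {a b : ℕ} (l : BoxPartition a b) :
    ∑ m : BoxPartition a b, stepWeight κ l.1 m.1 * jacobiTrudiDet D P m.1 =
      jacobiTrudiDet D (P * (1 + x • X)) l.1 :=
  sum_stepWeight_smul_alternating (v := fun i t => jacobiTrudiRow a i t (P * D t))
    (v' := fun i t => jacobiTrudiRow a i t (P * (1 + x • X) * D t)) (hκ P a)
    (jacobiTrudiRow_self_zero a _) Matrix.detRowAlternating l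

theorem jacobiTrudiDet_eq_ite {a : ℕ} {D : ℕ → R⟦X⟧} {P : R⟦X⟧}
    (h0 : constantCoeff (P * D 0) = 1) (hpos : ∀ n t, 0 < t → t ≤ n → coeff n (P * D t) = 0)
    {l : Fin a → ℕ} (hl : Antitone l) :
    jacobiTrudiDet D P l = if l = 0 then 1 else 0 := by
  split_ifs with h
  · have upper : Matrix.IsUpperTriangular
        (fun i : Fin a => jacobiTrudiRow a i (l i) (P * D (l i))) := by
      intro i j hij
      have : ¬ (i : ℕ) ≤ j := not_le.2 hij
      simp [h, coeff_X_pow_mul', this]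
    rw [jacobiTrudiDet, Matrix.det_of_isUpperTriangular upper]
    exact prod_eq_one fun i _ => by simpa [h, coeff_X_pow_mul'] using h0
  · obtain ⟨i, hi⟩ := Function.ne_iff.1 h
    refine Matrix.det_eq_zero_of_row_eq_zero (⟨0, i.pos⟩ : Fin a) fun j => ?_
    have hpos₀ : 0 < l ⟨0, i.pos⟩ :=
      (Nat.pos_of_ne_zero hi).trans_le (hl (Fin.le_def.2 (Nat.zero_le _)))
    simpa using hpos _ _ hpos₀ (Nat.le_add_right _ _)

/-- A part that moves has weight `x`. -/
def jumpKernel (x : R) (l t : ℕ) : R := if t < l then x else 1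

/-- A part moves by at most one, and has weight `x` if it moves. -/
def stripKernel (x : R) (l t : ℕ) : R := if l ≤ t + 1 then jumpKernel x l t else 0

theorem isTransferKernel_jumpKernel (x : R) :
    IsTransferKernel (fun t => (1 + X) ^ t) (jumpKernel x) x := by
  intro P a i s l h
  set row : ℕ → ℕ → Fin a → R := fun i t => jacobiTrudiRow a i t (P * (1 + X) ^ t)
  have row_eq_sub : ∀ t, row i t = row (i + 1) (t + 1) - row (i + 1) t := by
    intro t
    have expand := jacobiTrudiRow_mul_one_add_smul_X a (i + 1) (t + 1) 1 (P * (1 + X) ^ t)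
    rw [one_smul, one_smul, mul_assoc, ← pow_succ, jacobiTrudiRow_succ_succ a i t (P * (1 + X) ^ t),
      jacobiTrudiRow_succ_succ a (i + 1) t] at expand
    exact eq_sub_of_add_eq expand.symm
  have telescope : ∑ t ∈ Ico s l, jumpKernel x l t • row i t =
      x • (row (i + 1) l - row (i + 1) s) := by
    rw [← sum_Ico_sub _ h, smul_sum]
    exact sum_congr rfl fun t ht => by
      rw [jumpKernel, if_pos (mem_Ico.1 ht).2, ← row_eq_sub]
  refine ⟨-x, ?_⟩
  rw [← sum_Ico_add_eq_sum_Icc h, telescope, mul_right_comm, jacobiTrudiRow_mul_one_add_smul_X,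
    jumpKernel, if_neg (lt_irrefl l)]
  module

theorem isTransferKernel_stripKernel (x : R) :
    IsTransferKernel (fun _ => 1) (stripKernel x) x := by
  intro P a i s l h
  simp only [mul_one, jacobiTrudiRow_mul_one_add_smul_X, ← sum_Ico_add_eq_sum_Icc h]
  have top : stripKernel x l l = 1 := by simp [stripKernel, jumpKernel]
  rcases h.eq_or_lt with rfl | h
  · exact ⟨-x, by rw [Ico_self, sum_empty, top]; module⟩
  · obtain ⟨l, rfl⟩ := Nat.exists_eq_add_of_lt h
    refine ⟨0, ?_⟩
    rw [sum_eq_single_of_mem (s + l) (by simp), top, jacobiTrudiRow_succ_succ]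
    · simp [stripKernel, jumpKernel, add_comm]
    · intro t ht htl
      have : ¬ s + l ≤ t := by have := mem_Ico.1 ht; omega
      simp [stripKernel, this]

/-- A sum over chains of transfer steps that descend to the empty partition; the generating function
`P` of the empty chain is one for which the determinants detect the empty partition. -/
theorem sum_chain_eq_sum_jacobiTrudiDet {a b n : ℕ} {D : ℕ → R⟦X⟧} {P : R⟦X⟧}
    (h0 : constantCoeff (P * D 0) = 1) (hpos : ∀ n t, 0 < t → t ≤ n → coeff n (P * D t) = 0)
    {κ : Fin n → ℕ → ℕ → R} {x : Fin n → R}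
    (hκ : ∀ k, IsTransferKernel D (κ k) (x k)) (u : BoxPartition a b → R) :
    ∑ M : Fin (n + 1) → BoxPartition a b,
        u (M 0) * (∏ k, stepWeight (κ k) (M k.castSucc).1 (M k.succ).1) *
          (if (M (Fin.last n)).1 = 0 then 1 else 0) =
      ∑ l, u l * jacobiTrudiDet D (P * ∏ k, (1 + x k • X)) l.1 := by
  simp only [← jacobiTrudiDet_eq_ite h0 hpos (BoxPartition.antitone _)]
  exact sum_chain (fun P (l : BoxPartition a b) => jacobiTrudiDet D P l.1)
    (fun k P l => sum_stepWeight_mul_jacobiTrudiDet (hκ k) P l) u P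

theorem sum_chain_stripKernel {n : ℕ} (a b : ℕ) (x : Fin n → R) :
    ∑ M : Fin (n + 1) → BoxPartition a b, (if M 0 = BoxPartition.full a b then 1 else 0) *
        (∏ k, stepWeight (stripKernel (x k)) (M k.castSucc).1 (M k.succ).1) *
          (if (M (Fin.last n)).1 = 0 then 1 else 0) =
      Matrix.det fun i : Fin a => jacobiTrudiRow a i b (∏ k, (1 + x k • X)) := by
  rw [sum_chain_eq_sum_jacobiTrudiDet (P := 1) (by simp)
    (fun n t ht htn => by rw [one_mul, coeff_one, if_neg (by omega)])
    (fun k => isTransferKernel_stripKernel (x k))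
    fun l => if l = BoxPartition.full a b then 1 else 0]
  simp only [ite_mul, one_mul, zero_mul, sum_ite_eq', mem_univ, if_true, jacobiTrudiDet, mul_one]
  rfl

theorem coeff_one_add_X_pow (b n : ℕ) : coeff n ((1 + X : R⟦X⟧) ^ b) = b.choose n := by
  rw [← Polynomial.coeff_one_add_X_pow R, ← Polynomial.coeff_coe]
  simp

/-- An initial transfer step of weight `1`, from the full box to an arbitrary partition, cancels the
factor `(1 + X)⁻¹` of the generating function of the empty chain. -/
theorem sum_chain_jumpKernel {n : ℕ} (a b : ℕ) (x : Fin n → R) :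
    ∑ M : Fin (n + 1) → BoxPartition a b,
        (∏ k, stepWeight (jumpKernel (x k)) (M k.castSucc).1 (M k.succ).1) *
          (if (M (Fin.last n)).1 = 0 then 1 else 0) =
      Matrix.det fun i : Fin a =>
        jacobiTrudiRow a i b ((∏ k, (1 + x k • X)) * (1 + X) ^ b) := by
  obtain ⟨P, hP⟩ : ∃ P : R⟦X⟧, P * (1 + X) = 1 :=
    ⟨invOfUnit (1 + X) 1, by rw [mul_comm]; exact mul_invOfUnit _ _ (by simp)⟩
  have h0 : constantCoeff (P * (1 + X) ^ 0) = 1 := by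
    simpa using congrArg constantCoeff hP
  have hpos : ∀ n t, 0 < t → t ≤ n → coeff n (P * (1 + X) ^ t) = 0 := by
    rintro n (_ | t) ht htn
    · omega
    · rw [pow_succ', ← mul_assoc, hP, one_mul, coeff_one_add_X_pow,
        Nat.choose_eq_zero_of_lt (by omega), Nat.cast_zero]
  have weight_one : ∀ l : BoxPartition a b,
      stepWeight (jumpKernel (1 : R)) (BoxPartition.full a b).1 l.1 = 1 := fun l => by
    rw [stepWeight, if_pos (show l.1 ≤ (BoxPartition.full a b).1 from l.apply_le)]
    exact prod_eq_one fun i _ => ite_self 1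
  have chains := sum_chain_eq_sum_jacobiTrudiDet (a := a) (b := b) h0 hpos
    (fun k => isTransferKernel_jumpKernel (x k)) fun l =>
      stepWeight (jumpKernel 1) (BoxPartition.full a b).1 l.1
  rw [sum_stepWeight_mul_jacobiTrudiDet (isTransferKernel_jumpKernel 1), one_smul,
    mul_right_comm, hP, one_mul] at chains
  simp only [weight_one, one_mul] at chains
  exact chains

end JacobiTrudi

/-! ### Level sets and descents of plane partitions -/

namespace PlanePartition

variable (π : PlanePartition)

theorem entry_anti {i i' j j' : ℕ} (hi : i ≤ i') (hj : j ≤ j') : π.entry i' j' ≤ π.entry i j :=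
  (antitone_nat_of_succ_le (f := fun i => π.entry i j') (fun i => π.col_le i j') hi).trans
    (antitone_nat_of_succ_le (π.row_le i) hj)

/-- The superlevel set `{(i,j) : π_{ij} > k}`: the `k`-th layer of the pile of cubes whose column
over `(i, j)` has height `π_{ij}`. -/
noncomputable def superlevel (k : ℕ) : YoungDiagram where
  cells := π.shape.cells.filter fun p => k < π.entry p.1 p.2
  isLowerSet := by
    intro p p' hp h
    simp only [Finset.coe_filter, Set.mem_ofPred_eq] at h ⊢
    exact ⟨π.shape.isLowerSet hp h.1, h.2.trans_le (π.entry_anti hp.1 hp.2)⟩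

theorem mem_shape {i j : ℕ} : (i, j) ∈ π.shape ↔ 0 < π.entry i j := by
  simp [← YoungDiagram.mem_cells, shape]

theorem mem_superlevel {i j k : ℕ} : (i, j) ∈ π.superlevel k ↔ k < π.entry i j := by
  rw [← YoungDiagram.mem_cells, superlevel, Finset.mem_filter, YoungDiagram.mem_cells, mem_shape]
  exact ⟨And.right, fun h => ⟨h.pos, h⟩⟩

theorem lt_colLen_superlevel {i j k : ℕ} :
    i < (π.superlevel k).colLen j ↔ k < π.entry i j := by
  rw [← YoungDiagram.mem_iff_lt_colLen, mem_superlevel]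

theorem lt_rowLen_superlevel {i j k : ℕ} :
    j < (π.superlevel k).rowLen i ↔ k < π.entry i j := by
  rw [← YoungDiagram.mem_iff_lt_rowLen, mem_superlevel]

theorem colLen_superlevel_anti {k k' : ℕ} (h : k ≤ k') (j : ℕ) :
    (π.superlevel k').colLen j ≤ (π.superlevel k).colLen j :=
  le_of_forall_lt fun _ hi => π.lt_colLen_superlevel.2 (h.trans_lt (π.lt_colLen_superlevel.1 hi))

theorem lt_lambda1 {j : ℕ} : j < π.lambda1 ↔ 0 < π.entry 0 j := by
  rw [lambda1, ← YoungDiagram.mem_iff_lt_rowLen, mem_shape]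

theorem lt_lambda1_of_lt_entry {i j k : ℕ} (h : k < π.entry i j) : j < π.lambda1 :=
  π.lt_lambda1.2 (h.pos.trans_le (π.entry_anti (Nat.zero_le i) le_rfl))

/-- The descents of `π` at which the entry is `k + 1`. -/
noncomputable def descentsAt (k : ℕ) : Finset (ℕ × ℕ) :=
  π.des.filter fun p => π.entry p.1 p.2 = k + 1

theorem mem_descentsAt {i j k : ℕ} :
    (i, j) ∈ π.descentsAt k ↔
      k < π.entry i j ∧ ¬ k + 1 < π.entry i j ∧ ¬ k < π.entry (i + 1) j := by
  rw [descentsAt, Finset.mem_filter, mem_des]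
  dsimp only
  omega

theorem mem_descentsAt_iff_colLen {i j k : ℕ} :
    (i, j) ∈ π.descentsAt k ↔
      (π.superlevel (k + 1)).colLen j ≤ i ∧ (π.superlevel k).colLen j = i + 1 := by
  simp only [mem_descentsAt, ← lt_colLen_superlevel]
  omega

theorem mem_descentsAt_iff_rowLen {i j k : ℕ} :
    (i, j) ∈ π.descentsAt k ↔ j < (π.superlevel k).rowLen i ∧
      max ((π.superlevel (k + 1)).rowLen i) ((π.superlevel k).rowLen (i + 1)) ≤ j := by
  simp only [mem_descentsAt, ← lt_rowLen_superlevel]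
  omega

/-- A column contains at most one descent of a given level. -/
theorem card_descentsAt_eq_card_columns {a : ℕ} (ha : π.lambda1 ≤ a) (k : ℕ) :
    (π.descentsAt k).card = (Finset.univ.filter fun j : Fin a =>
      (π.superlevel (k + 1)).colLen j < (π.superlevel k).colLen j).card := by
  symm
  refine Finset.card_bij (fun j _ => ((π.superlevel k).colLen j - 1, (j : ℕ))) ?_ ?_ ?_
  · intro j hj
    have := (Finset.mem_filter.1 hj).2
    rw [mem_descentsAt_iff_colLen]
    omega
  · intro j _ j' _ h
    exact Fin.ext (Prod.ext_iff.1 h).2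
  · rintro ⟨i, j⟩ h
    have hj : j < a := (π.lt_lambda1_of_lt_entry (π.mem_descentsAt.1 h).1).trans_le ha
    rw [mem_descentsAt_iff_colLen] at h
    exact ⟨⟨j, hj⟩, Finset.mem_filter.2 ⟨Finset.mem_univ _, by dsimp only; omega⟩,
      Prod.ext (by dsimp only; omega) rfl⟩

end PlanePartition

theorem lt_sInf_compl {s : Set ℕ} (hs : IsLowerSet s) (hne : sᶜ.Nonempty) {k : ℕ} :
    k < sInf sᶜ ↔ k ∈ s :=
  ⟨fun h => not_not.1 (Nat.notMem_of_lt_sInf h), fun hk =>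
    not_le.1 fun h => Nat.sInf_mem hne (hs h hk)⟩

namespace PP

variable {a b c : ℕ}

theorem lt_of_lt_entry (π : PP b c) {i j k : ℕ} (h : k < π.entry i j) : i < b ∧ k < c := by
  refine ⟨?_, h.trans_le (π.entry_le i j)⟩
  have hi : i < π.shape.colLen j := YoungDiagram.mem_iff_lt_colLen.1 (π.mem_shape.2 h.pos)
  exact hi.trans_le ((π.shape.colLen_anti 0 j (Nat.zero_le j)).trans π.rows_le)

theorem ext_lt {π π' : PP b c} (h : ∀ i j k, k < π.entry i j ↔ k < π'.entry i j) : π = π' :=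
  PP.ext (funext fun i => funext fun j => eq_of_forall_lt_iff (h i j))

section OfSolid

variable {D : Set (ℕ × ℕ × ℕ)}

theorem mem_solid_of_le (hD : IsLowerSet D) {i i' j j' k k' : ℕ} (h : (i, j, k) ∈ D)
    (hi : i' ≤ i) (hj : j' ≤ j) (hk : k' ≤ k) : (i', j', k') ∈ D :=
  hD (a := (i, j, k)) (b := (i', j', k')) ⟨hi, hj, hk⟩ h

theorem lt_height_iff (hD : IsLowerSet D) (hbox : ∀ i j k, (i, j, k) ∈ D → i < b ∧ j < a ∧ k < c)
    {i j k : ℕ} : k < sInf {k | (i, j, k) ∈ D}ᶜ ↔ (i, j, k) ∈ D :=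
  lt_sInf_compl (s := {k | (i, j, k) ∈ D}) (fun _ _ h hk => mem_solid_of_le hD hk le_rfl le_rfl h)
    ⟨c, fun h => (hbox i j c h).2.2.false⟩

variable (hD : IsLowerSet D) (hbox : ∀ i j k, (i, j, k) ∈ D → i < b ∧ j < a ∧ k < c)

/-- The plane partition whose pile of cubes is a given lower set of `ℕ³` inside a box. -/
noncomputable def ofSolid : PP b c where
  entry i j := sInf {k | (i, j, k) ∈ D}ᶜ
  col_le i j := le_of_forall_lt fun k hk => (lt_height_iff hD hbox).2 <|
    mem_solid_of_le hD ((lt_height_iff hD hbox).1 hk) (Nat.le_succ i) le_rfl le_rfl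
  row_le i j := le_of_forall_lt fun k hk => (lt_height_iff hD hbox).2 <|
    mem_solid_of_le hD ((lt_height_iff hD hbox).1 hk) le_rfl (Nat.le_succ j) le_rfl
  finite_support := (Finset.range b ×ˢ Finset.range a).finite_toSet.subset fun p hp => by
    have hp := hbox _ _ _ ((lt_height_iff hD hbox).1 hp)
    simp [hp.1, hp.2.1]
  rows_le := le_of_forall_lt fun i hi => (hbox i 0 0 <| (lt_height_iff hD hbox).1 <|
    (PlanePartition.mem_shape _).1 <| YoungDiagram.mem_iff_lt_colLen.2 hi).1
  entry_le i j := le_of_forall_lt fun k hk => (hbox i j k ((lt_height_iff hD hbox).1 hk)).2.2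

theorem lt_entry_ofSolid {i j k : ℕ} : k < (ofSolid hD hbox).entry i j ↔ (i, j, k) ∈ D :=
  lt_height_iff hD hbox

theorem lambda1_ofSolid_le : (ofSolid hD hbox).lambda1 ≤ a :=
  le_of_forall_lt fun j hj =>
    (hbox 0 j 0 ((lt_entry_ofSolid hD hbox).1 ((PlanePartition.lt_lambda1 _).1 hj))).2.1

end OfSolid

/-- The column lengths of the `k`-th layer of `π`; only the first `a` columns are recorded. -/
noncomputable def levels (a : ℕ) (π : PP b c) (k : ℕ) : BoxPartition a b :=
  ⟨fun j => (π.superlevel k).colLen j, mem_partitionsBelow.2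
    ⟨fun _ => le_of_forall_lt fun _ hi => (π.lt_of_lt_entry (π.lt_colLen_superlevel.1 hi)).1,
      fun _ _ h => (π.superlevel k).colLen_anti _ _ h⟩⟩

theorem lt_levels (π : PP b c) {i k : ℕ} {j : Fin a} :
    i < (π.levels a k).1 j ↔ k < π.entry i j :=
  π.lt_colLen_superlevel

theorem levels_succ_le (π : PP b c) (k : ℕ) : (π.levels a (k + 1)).1 ≤ (π.levels a k).1 :=
  fun j => π.colLen_superlevel_anti (Nat.le_succ k) j

theorem levels_last (π : PP b c) : (π.levels a c).1 = 0 :=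
  funext fun _ => Nat.eq_zero_of_le_zero <| le_of_forall_lt fun _ hi =>
    absurd (π.lt_of_lt_entry (π.lt_levels.1 hi)).2 (lt_irrefl c)

/-- The pile of cubes whose layers have the column lengths prescribed by `M`. -/
def solidOfLevels (M : Fin (c + 1) → BoxPartition a b) : Set (ℕ × ℕ × ℕ) :=
  {p | ∃ (hj : p.2.1 < a) (hk : p.2.2 < c + 1), p.1 < (M ⟨p.2.2, hk⟩).1 ⟨p.2.1, hj⟩}

theorem isLowerSet_solidOfLevels {M : Fin (c + 1) → BoxPartition a b} (hM : Antitone M) :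
    IsLowerSet (solidOfLevels M) := by
  rintro ⟨i, j, k⟩ ⟨i', j', k'⟩ ⟨hi, hj, hk⟩ ⟨hja, hkc, h⟩
  refine ⟨hj.trans_lt hja, hk.trans_lt hkc, ?_⟩
  calc i' ≤ i := hi
    _ < (M ⟨k, hkc⟩).1 ⟨j, hja⟩ := h
    _ ≤ (M ⟨k, hkc⟩).1 ⟨j', _⟩ := (M _).antitone hj
    _ ≤ (M ⟨k', _⟩).1 ⟨j', _⟩ := hM (Fin.mk_le_mk.2 hk) _

theorem solidOfLevels_subset_box {M : Fin (c + 1) → BoxPartition a b}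
    (hlast : (M (Fin.last c)).1 = 0) (i j k : ℕ) (h : (i, j, k) ∈ solidOfLevels M) :
    i < b ∧ j < a ∧ k < c := by
  obtain ⟨hj, hk, h⟩ := h
  refine ⟨h.trans_le ((M _).apply_le _), hj, (Nat.lt_succ_iff.1 hk).lt_of_ne ?_⟩
  rintro rfl
  exact absurd h (by rw [show (⟨k, hk⟩ : Fin (k + 1)) = Fin.last k from rfl, hlast]; simp)

section OfLevels

variable {M : Fin (c + 1) → BoxPartition a b} (hM : Antitone M) (hlast : (M (Fin.last c)).1 = 0)

/-- The plane partition whose layers have the column lengths prescribed by `M`. -/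
noncomputable def ofLevels : PP b c :=
  ofSolid (isLowerSet_solidOfLevels hM) (solidOfLevels_subset_box hlast)

theorem lt_entry_ofLevels {i j k : ℕ} :
    k < (ofLevels hM hlast).entry i j ↔ (i, j, k) ∈ solidOfLevels M :=
  lt_entry_ofSolid _ _

theorem lambda1_ofLevels_le : (ofLevels hM hlast).lambda1 ≤ a :=
  lambda1_ofSolid_le _ _

end OfLevels

/-- A plane partition with at most `a` columns amounts to the chain of its layers. -/
noncomputable def levelsEquiv (a b c : ℕ) : {π : PP b c // π.lambda1 ≤ a} ≃
    {M : Fin (c + 1) → BoxPartition a b // Antitone M ∧ (M (Fin.last c)).1 = 0} where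
  toFun π := ⟨fun k => π.1.levels a k,
    Fin.antitone_iff_succ_le.2 fun k => π.1.levels_succ_le k, π.1.levels_last⟩
  invFun M := ⟨ofLevels M.2.1 M.2.2, lambda1_ofLevels_le _ _⟩
  left_inv π := by
    refine Subtype.ext (ext_lt fun i j k => ?_)
    rw [lt_entry_ofLevels]
    refine ⟨?_, fun h => ?_⟩
    · rintro ⟨hj, hk, h⟩
      exact π.1.lt_levels.1 h
    · exact ⟨(π.1.lt_lambda1_of_lt_entry h).trans_le π.2,
        Nat.lt_succ_of_lt (π.1.lt_of_lt_entry h).2, π.1.lt_levels.2 h⟩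
  right_inv M := by
    refine Subtype.ext (funext fun k => Subtype.ext (funext fun j => ?_))
    refine eq_of_forall_lt_iff fun i => ?_
    rw [lt_levels, lt_entry_ofLevels]
    exact ⟨fun ⟨_, _, h⟩ => h, fun h => ⟨j.2, k.2, h⟩⟩

noncomputable instance (a b c : ℕ) : Fintype {π : PP b c // π.lambda1 ≤ a} :=
  have := Finite.of_equiv _ (levelsEquiv a b c).symm
  Fintype.ofFinite _

theorem sum_lambda1_le_eq_sum_chain {R : Type*} [CommSemiring R] (a : ℕ) (κ : Fin c → ℕ → ℕ → R)
    (u : BoxPartition a b → R) :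
    ∑ π : {π : PP b c // π.lambda1 ≤ a}, u (π.1.levels a 0) *
        ∏ k : Fin c, stepWeight (κ k) (π.1.levels a k).1 (π.1.levels a (k + 1)).1 =
      ∑ M : Fin (c + 1) → BoxPartition a b,
        u (M 0) * (∏ k, stepWeight (κ k) (M k.castSucc).1 (M k.succ).1) *
          (if (M (Fin.last c)).1 = 0 then 1 else 0) := by
  classical
  have weight_eq_zero : ∀ M : Fin (c + 1) → BoxPartition a b, ¬ Antitone M →
      ∏ k, stepWeight (κ k) (M k.castSucc).1 (M k.succ).1 = 0 := by
    intro M hM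
    rw [Fin.antitone_iff_succ_le, not_forall] at hM
    obtain ⟨k, hk⟩ := hM
    exact Finset.prod_eq_zero (Finset.mem_univ k) (if_neg hk)
  let summand (M : Fin (c + 1) → BoxPartition a b) : R :=
    u (M 0) * ∏ k, stepWeight (κ k) (M k.castSucc).1 (M k.succ).1
  calc
    _ = ∑ M : {M : Fin (c + 1) → BoxPartition a b // Antitone M ∧ (M (Fin.last c)).1 = 0},
          summand M.1 := Fintype.sum_equiv (levelsEquiv a b c) _ _ fun _ => rfl
    _ = ∑ M with Antitone M ∧ (M (Fin.last c)).1 = 0, summand M :=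
      (Finset.sum_subtype _ (by simp) summand).symm
    _ = _ := by
      rw [Finset.sum_filter]
      refine Finset.sum_congr rfl fun M _ => ?_
      by_cases hM : Antitone M
      · simp [summand, hM]
      · simp [hM, weight_eq_zero M hM]

theorem gWeight_eq_prod_pow (q : Fin c → ℝ) (π : PP b c) :
    gWeight b q π = ∏ k : Fin c, q k ^ (π.descentsAt k).card := by
  rw [gWeight, ← Finset.prod_fiberwise' Finset.univ π.level q]
  refine Finset.prod_congr rfl fun k _ => ?_
  rw [Finset.prod_const]
  congr 1
  have level_eq_iff : ∀ p : π.des, π.level p = k ↔ π.entry p.1.1 p.1.2 = k + 1 := fun p => by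
    have := (π.mem_des p.1).1 p.2
    simp only [level, Fin.ext_iff]
    omega
  refine Finset.card_bij (fun p _ => p.1) (fun p hp => ?_) (fun _ _ _ _ => Subtype.ext) ?_
  · exact Finset.mem_filter.2 ⟨p.2, (level_eq_iff p).1 (Finset.mem_filter.1 hp).2⟩
  · intro p hp
    obtain ⟨hdes, hp⟩ := Finset.mem_filter.1 hp
    exact ⟨⟨p, hdes⟩, Finset.mem_filter.2 ⟨Finset.mem_univ _, (level_eq_iff ⟨p, hdes⟩).2 hp⟩, rfl⟩

theorem gWeight_eq_prod_stepWeight (q : Fin c → ℝ) {π : PP b c} (ha : π.lambda1 ≤ a) :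
    gWeight b q π = ∏ k : Fin c,
      stepWeight (jumpKernel (q k)) (π.levels a k).1 (π.levels a (k + 1)).1 := by
  rw [gWeight_eq_prod_pow]
  refine Finset.prod_congr rfl fun k _ => ?_
  rw [stepWeight, if_pos (π.levels_succ_le k), π.card_descentsAt_eq_card_columns ha]
  simp only [jumpKernel, Finset.prod_ite, Finset.prod_const, one_pow, mul_one]
  rfl

open PowerSeries in
theorem sum_gWeight_lambda1_le (a : ℕ) (q : Fin c → ℝ) :
    ∑ π : {π : PP b c // π.lambda1 ≤ a}, gWeight b q π.1 =
      Matrix.det fun i : Fin a =>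
        jacobiTrudiRow a i b ((∏ k, (1 + q k • X)) * (1 + X) ^ b) := by
  have h := sum_lambda1_le_eq_sum_chain (b := b) a (fun k => jumpKernel (q k)) fun _ => 1
  simp only [one_mul, sum_chain_jumpKernel] at h
  rw [← h]
  exact Finset.sum_congr rfl fun π _ => gWeight_eq_prod_stepWeight q π.2

end PP

/-! ### Semistandard tableaux of rectangular shape -/

theorem stepWeight_stripKernel {R : Type*} [CommRing R] {a : ℕ} (x : R) (l m : Fin a → ℕ)
    [Decidable (∀ j, l j ≤ m j + 1)] :
    stepWeight (stripKernel x) l m =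
      if ∀ j, l j ≤ m j + 1 then stepWeight (jumpKernel x) l m else 0 := by
  classical
  have prod_eq := Finset.prod_ite_zero (s := Finset.univ) (p := fun j => l j ≤ m j + 1)
    (f := fun j => jumpKernel x (l j) (m j))
  simp only [Finset.mem_univ, forall_true_left] at prod_eq
  simp only [stepWeight, stripKernel, prod_eq]
  split_ifs <;> rfl

namespace PP

variable {a b c : ℕ}

/-- Strict decrease down the columns of the first `a` columns; the entries in row `b` are zero, so
those above them are positive. -/
def IsColumnStrict (a : ℕ) (π : PP b c) : Prop :=
  ∀ i < b, ∀ j < a, π.entry (i + 1) j < π.entry i j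

theorem isColumnStrict_iff_levels {π : PP b c} :
    IsColumnStrict a π ↔ π.levels a 0 = BoxPartition.full a b ∧
      ∀ k : Fin c, ∀ j, (π.levels a k).1 j ≤ (π.levels a (k + 1)).1 j + 1 := by
  rw [BoxPartition.eq_full_iff]
  constructor
  · refine fun hπ => ⟨fun j => ((π.levels a 0).apply_le j).antisymm ?_, fun k j => ?_⟩
    · exact le_of_forall_lt fun i hi => π.lt_levels.2 (hπ i hi j j.2).pos
    · refine le_of_forall_lt fun i hi => ?_
      rcases i with _ | i
      · exact Nat.succ_pos _
      · have hk := π.lt_levels.1 hi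
        have hib := (Nat.lt_succ_self i).trans (π.lt_of_lt_entry hk).1
        exact Nat.succ_lt_succ (π.lt_levels.2 ((Nat.succ_le_of_lt hk).trans_lt (hπ i hib j j.2)))
  · rintro ⟨hfull, hstep⟩ i hi j hj
    rcases hk : π.entry (i + 1) j with _ | k
    · exact (π.lt_levels (j := ⟨j, hj⟩)).1 (hi.trans_eq (hfull _).symm)
    · have hlt : k < π.entry (i + 1) j := hk ▸ Nat.lt_succ_self k
      refine (π.lt_levels (j := ⟨j, hj⟩)).1 (Nat.lt_of_succ_lt_succ ?_)
      exact (π.lt_levels.2 hlt).trans_le (hstep ⟨k, (π.lt_of_lt_entry hlt).2⟩ ⟨j, hj⟩)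

open PowerSeries in
theorem sum_gWeight_isColumnStrict (a : ℕ) (q : Fin c → ℝ)
    [DecidablePred fun π : PP b c => IsColumnStrict a π] :
    ∑ π : {π : PP b c // π.lambda1 ≤ a},
        (if IsColumnStrict a π.1 then gWeight b q π.1 else 0) =
      Matrix.det fun i : Fin a => jacobiTrudiRow a i b (∏ k, (1 + q k • X)) := by
  classical
  rw [← sum_chain_stripKernel]
  refine Eq.trans ?_ (sum_lambda1_le_eq_sum_chain a (fun k => stripKernel (q k))
    fun l => if l = BoxPartition.full a b then 1 else 0)
  refine Finset.sum_congr rfl fun π _ => ?_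
  have strip_weight : ∏ k : Fin c,
        stepWeight (stripKernel (q k)) (π.1.levels a k).1 (π.1.levels a (k + 1)).1 =
      if ∀ k : Fin c, ∀ j, (π.1.levels a k).1 j ≤ (π.1.levels a (k + 1)).1 j + 1
        then gWeight b q π.1 else 0 := by
    simp only [stepWeight_stripKernel, Finset.prod_ite_zero, Finset.mem_univ, forall_true_left,
      gWeight_eq_prod_stepWeight q π.2]
  rw [strip_weight, ite_mul, one_mul, zero_mul, ← ite_and]
  simp only [isColumnStrict_iff_levels]

end PP

section Tableaux

variable {a b n : ℕ}

theorem mem_rectDiagram {i j : ℕ} : (i, j) ∈ rectDiagram a b ↔ i < b ∧ j < a := by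
  simp [← YoungDiagram.mem_cells, rectDiagram]

namespace BoundedSSYT

variable (T : BoundedSSYT (rectDiagram a b) n)

theorem apply_lt {i j : ℕ} (hi : i < b) (hj : j < a) : T.1 i j < n :=
  T.2 (i, j) ((YoungDiagram.mem_cells _).2 (mem_rectDiagram.2 ⟨hi, hj⟩))

/-- The pile of cubes with height `n - T i j` over each cell `(i, j)` of the rectangle. -/
def solid : Set (ℕ × ℕ × ℕ) := {p | p.1 < b ∧ p.2.1 < a ∧ T.1 p.1 p.2.1 + p.2.2 < n}

theorem isLowerSet_solid : IsLowerSet T.solid := by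
  rintro ⟨i, j, k⟩ ⟨i', j', k'⟩ ⟨hi, hj, hk⟩ ⟨hib, hja, h⟩
  have hj'a : j' < a := hj.trans_lt hja
  refine ⟨hi.trans_lt hib, hj'a, lt_of_le_of_lt (add_le_add ?_ hk) h⟩
  calc T.1 i' j' ≤ T.1 i j' := T.1.col_weak hi (mem_rectDiagram.2 ⟨hib, hj'a⟩)
    _ ≤ T.1 i j := T.1.row_weak_of_le hj (mem_rectDiagram.2 ⟨hib, hja⟩)

theorem solid_subset_box (i j k : ℕ) (h : (i, j, k) ∈ T.solid) : i < b ∧ j < a ∧ k < n :=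
  ⟨h.1, h.2.1, (Nat.le_add_left _ _).trans_lt h.2.2⟩

/-- The column-strict plane partition obtained by complementing the entries of a tableau. -/
noncomputable def toPP : PP b n := PP.ofSolid T.isLowerSet_solid T.solid_subset_box

theorem lt_entry_toPP {i j k : ℕ} :
    k < T.toPP.entry i j ↔ i < b ∧ j < a ∧ T.1 i j + k < n :=
  PP.lt_entry_ofSolid _ _

theorem lambda1_toPP_le : T.toPP.lambda1 ≤ a := PP.lambda1_ofSolid_le _ _

theorem entry_toPP {i j : ℕ} (hi : i < b) (hj : j < a) : T.toPP.entry i j = n - T.1 i j :=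
  eq_of_forall_lt_iff fun k => by
    rw [lt_entry_toPP]
    omega

theorem isColumnStrict_toPP : T.toPP.IsColumnStrict a := by
  intro i hi j hj
  rw [lt_entry_toPP]
  refine ⟨hi, hj, ?_⟩
  rcases hk : T.toPP.entry (i + 1) j with _ | k
  · exact T.apply_lt hi hj
  · have below := T.lt_entry_toPP.1 (hk.symm ▸ Nat.lt_succ_self k : k < T.toPP.entry (i + 1) j)
    have := T.1.col_strict (Nat.lt_add_one i) (mem_rectDiagram.2 ⟨below.1, hj⟩)
    omega

theorem mem_des_toPP {p : ℕ × ℕ} : p ∈ T.toPP.des ↔ p ∈ (rectDiagram a b).cells := by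
  rw [PlanePartition.mem_des, YoungDiagram.mem_cells, mem_rectDiagram]
  refine ⟨fun h => ?_, fun h => T.isColumnStrict_toPP _ h.1 _ h.2⟩
  have := T.lt_entry_toPP.1 h
  exact ⟨this.1, this.2.1⟩

theorem gWeight_toPP (x : Fin n → ℝ) :
    gWeight b (x ∘ Fin.rev) T.toPP =
      ∏ p : (rectDiagram a b).cells, x ⟨T.1 p.1.1 p.1.2, T.2 p.1 p.2⟩ := by
  refine Fintype.prod_equiv (Equiv.subtypeEquivRight fun p => T.mem_des_toPP) _ _ ?_
  rintro ⟨⟨i, j⟩, hp⟩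
  obtain ⟨hi, hj⟩ := mem_rectDiagram.1 ((YoungDiagram.mem_cells _).1 (T.mem_des_toPP.1 hp))
  have := T.apply_lt hi hj
  have := T.entry_toPP hi hj
  refine congrArg x (Fin.ext ?_)
  simp only [Fin.val_rev, PP.level, Equiv.subtypeEquivRight_apply_coe]
  omega

/-- The inverse of `BoundedSSYT.toPP`. -/
def ofPP (π : PP b n) (hπ : π.IsColumnStrict a) : BoundedSSYT (rectDiagram a b) n where
  val :=
    { entry := fun i j => if (i, j) ∈ rectDiagram a b then n - π.entry i j else 0
      row_weak' := fun {i j₁ j₂} hj h => by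
        rw [if_pos h, if_pos ((rectDiagram a b).up_left_mem le_rfl hj.le h)]
        exact Nat.sub_le_sub_left (π.entry_anti le_rfl hj.le) n
      col_strict' := fun {i₁ i₂ j} hi h => by
        have h₁ := (rectDiagram a b).up_left_mem hi.le le_rfl h
        rw [if_pos h, if_pos h₁]
        obtain ⟨hi₁, hj⟩ := mem_rectDiagram.1 h₁
        have strict : π.entry i₂ j < π.entry i₁ j :=
          (π.entry_anti (Nat.succ_le_of_lt hi) le_rfl).trans_lt (hπ i₁ hi₁ j hj)
        exact Nat.sub_lt_sub_left (strict.trans_le (π.entry_le i₁ j)) strict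
      zeros' := fun h => if_neg h }
  property p hp := by
    obtain ⟨hi, hj⟩ := mem_rectDiagram.1 ((YoungDiagram.mem_cells _).1 hp)
    have positive : 0 < π.entry p.1 p.2 := (hπ p.1 hi p.2 hj).pos
    have bounded := π.entry_le p.1 p.2
    change (if p ∈ rectDiagram a b then n - π.entry p.1 p.2 else 0) < n
    rw [if_pos ((YoungDiagram.mem_cells _).1 hp)]
    omega

theorem ofPP_apply {π : PP b n} (hπ : π.IsColumnStrict a) {i j : ℕ} (hi : i < b) (hj : j < a) :
    (ofPP π hπ).1 i j = n - π.entry i j :=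
  if_pos (mem_rectDiagram.2 ⟨hi, hj⟩)

/-- Complementation, as a bijection. -/
noncomputable def equivPP (a b n : ℕ) : BoundedSSYT (rectDiagram a b) n ≃
    {π : {π : PP b n // π.lambda1 ≤ a} // π.1.IsColumnStrict a} where
  toFun T := ⟨⟨T.toPP, T.lambda1_toPP_le⟩, T.isColumnStrict_toPP⟩
  invFun π := ofPP π.1.1 π.2
  left_inv T := by
    refine Subtype.ext (SemistandardYoungTableau.ext fun i j => ?_)
    by_cases h : (i, j) ∈ rectDiagram a b
    · obtain ⟨hi, hj⟩ := mem_rectDiagram.1 h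
      rw [ofPP_apply _ hi hj, entry_toPP T hi hj, Nat.sub_sub_self (T.apply_lt hi hj).le]
    · rw [T.1.zeros h, SemistandardYoungTableau.zeros _ h]
  right_inv π := by
    refine Subtype.ext (Subtype.ext (PP.ext_lt fun i j k => ?_))
    rw [lt_entry_toPP]
    constructor
    · rintro ⟨hi, hj, h⟩
      rw [ofPP_apply _ hi hj] at h
      omega
    · intro h
      have hi := (π.1.1.lt_of_lt_entry h).1
      have hj := (π.1.1.lt_lambda1_of_lt_entry h).trans_le π.1.2
      have := π.1.1.entry_le i j
      refine ⟨hi, hj, ?_⟩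
      rw [ofPP_apply _ hi hj]
      omega

end BoundedSSYT

open PowerSeries in
theorem eval_schurPoly_rectDiagram (a b : ℕ) (x : Fin n → ℝ) :
    MvPolynomial.eval x (schurPoly (rectDiagram a b) n) =
      Matrix.det fun i : Fin a => jacobiTrudiRow a i b (∏ k, (1 + x k • X)) := by
  classical
  have rev_prod : ∏ k, (1 + x k • X : ℝ⟦X⟧) = ∏ k, (1 + (x ∘ Fin.rev) k • X) :=
    (Equiv.prod_comp Fin.revPerm fun k => 1 + x k • X).symm
  simp only [schurPoly, map_sum, map_prod, MvPolynomial.eval_X, ← BoundedSSYT.gWeight_toPP]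
  rw [rev_prod, ← PP.sum_gWeight_isColumnStrict, ← Finset.sum_filter, Finset.sum_subtype _
    (p := fun π : {π : PP b n // π.lambda1 ≤ a} => π.1.IsColumnStrict a) (by simp)]
  exact Fintype.sum_equiv (BoundedSSYT.equivPP a b n) _ _ fun _ => rfl

end Tableaux

/-! ### Last passage times -/

section LastPassage

variable {b c : ℕ} (d : Fin b → Fin c → ℕ)

/-- Last passage times: the largest weight of a path of increasing coordinates that starts at the
cell `(i, k)` of the array `d`. -/
def lastPassage (i k : ℕ) : ℕ :=
  if h : i < b ∧ k < c then
    d ⟨i, h.1⟩ ⟨k, h.2⟩ + max (lastPassage i (k + 1)) (lastPassage (i + 1) k)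
  else 0
termination_by b - i + (c - k)

theorem lastPassage_eq (i : Fin b) (k : Fin c) :
    lastPassage d i k = d i k + max (lastPassage d i (k + 1)) (lastPassage d (i + 1) k) := by
  rw [lastPassage, dif_pos ⟨i.2, k.2⟩]

theorem lastPassage_eq_zero {i k : ℕ} (h : ¬ (i < b ∧ k < c)) : lastPassage d i k = 0 := by
  rw [lastPassage, dif_neg h]

theorem lastPassage_succ_le (i k : ℕ) :
    lastPassage d i (k + 1) ≤ lastPassage d i k ∧ lastPassage d (i + 1) k ≤ lastPassage d i k := by
  by_cases h : i < b ∧ k < c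
  · rw [lastPassage_eq d ⟨i, h.1⟩ ⟨k, h.2⟩]
    dsimp only
    omega
  · rw [lastPassage_eq_zero d (i := i) (k := k + 1) (by omega),
      lastPassage_eq_zero d (i := i + 1) (k := k) (by omega)]
    simp

theorem lastPassage_anti {i i' k k' : ℕ} (hi : i ≤ i') (hk : k ≤ k') :
    lastPassage d i' k' ≤ lastPassage d i k :=
  (antitone_nat_of_succ_le (f := fun i => lastPassage d i k')
    (fun i => (lastPassage_succ_le d i k').2) hi).trans
    (antitone_nat_of_succ_le (fun k => (lastPassage_succ_le d i k).1) hk)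

theorem eq_lastPassage {L : ℕ → ℕ → ℕ} (hzero : ∀ i k, ¬ (i < b ∧ k < c) → L i k = 0)
    (hrec : ∀ (i : Fin b) (k : Fin c), L i k = d i k + max (L i (k + 1)) (L (i + 1) k))
    (i k : ℕ) : L i k = lastPassage d i k := by
  fun_induction lastPassage d i k with
  | case1 i k h ih₁ ih₂ => rw [hrec ⟨i, h.1⟩ ⟨k, h.2⟩, ih₁, ih₂]
  | case2 i k h => exact hzero i k h

end LastPassage

namespace PP

variable {b c : ℕ}

/-- The number of descents in row `i` at which the entry is `k + 1`. -/
noncomputable def descentCount (π : PP b c) (i : Fin b) (k : Fin c) : ℕ :=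
  (π.superlevel k).rowLen i -
    max ((π.superlevel (k + 1)).rowLen i) ((π.superlevel k).rowLen (i + 1))

theorem card_descentsAt_eq_sum_descentCount (π : PP b c) (k : Fin c) :
    (π.descentsAt k).card = ∑ i, π.descentCount i k := by
  have row_lt : ∀ p ∈ π.descentsAt k, p.1 ∈ (Finset.range b : Set ℕ) := fun p hp =>
    Finset.mem_coe.2 <| Finset.mem_range.2 (π.lt_of_lt_entry (π.mem_descentsAt.1 hp).1).1
  rw [Finset.card_eq_sum_card_fiberwise row_lt, Finset.sum_range]
  refine Finset.sum_congr rfl fun i _ => ?_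
  have row_eq : {p ∈ π.descentsAt k | p.1 = (i : ℕ)} = {(i : ℕ)} ×ˢ Finset.Ico
      (max ((π.superlevel (k + 1)).rowLen i) ((π.superlevel k).rowLen (i + 1)))
      ((π.superlevel k).rowLen i) := by
    ext ⟨i', j⟩
    simp only [Finset.mem_filter, Finset.mem_product, Finset.mem_singleton, Finset.mem_Ico,
      PlanePartition.mem_descentsAt_iff_rowLen]
    constructor
    · rintro ⟨⟨hlt, hle⟩, rfl⟩
      exact ⟨rfl, hle, hlt⟩
    · rintro ⟨rfl, hle, hlt⟩
      exact ⟨⟨hlt, hle⟩, rfl⟩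
  rw [row_eq, Finset.card_product, Finset.card_singleton, Nat.card_Ico, one_mul, descentCount]

theorem gWeight_eq_prod_descentCount (q : Fin c → ℝ) (π : PP b c) :
    gWeight b q π = ∏ i, ∏ k, q k ^ π.descentCount i k := by
  rw [gWeight_eq_prod_pow, Finset.prod_comm]
  refine Finset.prod_congr rfl fun k _ => ?_
  rw [card_descentsAt_eq_sum_descentCount, Finset.prod_pow_eq_pow_sum]

theorem rowLen_superlevel_eq_add_max (π : PP b c) (i : Fin b) (k : Fin c) :
    (π.superlevel k).rowLen i = π.descentCount i k +
      max ((π.superlevel (k + 1)).rowLen i) ((π.superlevel k).rowLen (i + 1)) := by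
  refine (Nat.sub_add_cancel (max_le (le_of_forall_lt fun j hj => ?_) ?_)).symm
  · rw [π.lt_rowLen_superlevel] at hj ⊢
    exact (Nat.lt_succ_self _).trans hj
  · exact (π.superlevel k).rowLen_anti _ _ (Nat.le_succ _)

theorem rowLen_superlevel_eq_lastPassage (π : PP b c) (i k : ℕ) :
    (π.superlevel k).rowLen i = lastPassage π.descentCount i k := by
  refine eq_lastPassage π.descentCount (L := fun i k => (π.superlevel k).rowLen i)
    (fun i k h => ?_) π.rowLen_superlevel_eq_add_max i k
  exact Nat.eq_zero_of_le_zero <| le_of_forall_lt fun j hj =>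
    absurd (π.lt_of_lt_entry (π.lt_rowLen_superlevel.1 hj)) h

theorem descentCount_injective :
    Function.Injective (descentCount : PP b c → Fin b → Fin c → ℕ) := fun π π' h =>
  ext_lt fun i j k => by
    rw [← π.lt_rowLen_superlevel, ← π'.lt_rowLen_superlevel, rowLen_superlevel_eq_lastPassage,
      rowLen_superlevel_eq_lastPassage, h]

theorem descentCount_surjective :
    Function.Surjective (descentCount : PP b c → Fin b → Fin c → ℕ) := by
  intro d
  let solid : Set (ℕ × ℕ × ℕ) := {p | p.2.1 < lastPassage d p.1 p.2.2}
  have solid_lower : IsLowerSet solid := by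
    rintro ⟨i, j, k⟩ ⟨i', j', k'⟩ ⟨hi, hj, hk⟩ h
    exact (hj.trans_lt h).trans_le (lastPassage_anti d hi hk)
  have solid_box : ∀ i j k, (i, j, k) ∈ solid → i < b ∧ j < lastPassage d 0 0 ∧ k < c := by
    intro i j k h
    have hik : i < b ∧ k < c :=
      by_contra fun hc => Nat.not_lt_zero j (h.trans_eq (lastPassage_eq_zero d hc))
    exact ⟨hik.1, h.trans_le (lastPassage_anti d (Nat.zero_le i) (Nat.zero_le k)), hik.2⟩
  let π : PP b c := ofSolid solid_lower solid_box
  have rowLen_eq : ∀ i k, (π.superlevel k).rowLen i = lastPassage d i k := fun i k =>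
    eq_of_forall_lt_iff fun j => π.lt_rowLen_superlevel.trans (lt_entry_ofSolid _ _)
  refine ⟨π, funext fun i => funext fun k => ?_⟩
  rw [descentCount, rowLen_eq, rowLen_eq, rowLen_eq, lastPassage_eq, Nat.add_sub_cancel]

/-- Plane partitions correspond to arrays of natural numbers. -/
noncomputable def descentCountEquiv (b c : ℕ) : PP b c ≃ (Fin b → Fin c → ℕ) :=
  Equiv.ofBijective descentCount ⟨descentCount_injective, descentCount_surjective⟩

end PP

theorem hasSum_prod_apply {R α : Type*} [NormedCommRing R] [CompleteSpace R] {n : ℕ}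
    {f : Fin n → α → R} {s : Fin n → R} (hf : ∀ i, HasSum (f i) (s i))
    (hnorm : ∀ i, Summable fun x => ‖f i x‖) :
    HasSum (fun d : Fin n → α => ∏ i, f i (d i)) (∏ i, s i) ∧
      Summable fun d : Fin n → α => ‖∏ i, f i (d i)‖ := by
  induction n with
  | zero => exact ⟨by simp, .of_finite⟩
  | succ n ih =>
    obtain ⟨tail_hasSum, tail_norm⟩ := ih (fun i => hf i.succ) fun i => hnorm i.succ
    let cons : α × (Fin n → α) ≃ (Fin (n + 1) → α) := Fin.consEquiv fun _ => α
    have pair_summable := summable_mul_of_summable_norm (hnorm 0) tail_norm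
    have pair_hasSum := (hf 0).mul tail_hasSum pair_summable
    have pair_norm := (hnorm 0).mul_norm tail_norm
    rw [← cons.symm.hasSum_iff] at pair_hasSum
    rw [← cons.symm.summable_iff] at pair_norm
    simp only [Fin.prod_univ_succ]
    exact ⟨pair_hasSum, pair_norm⟩

theorem hasSum_gWeight (b : ℕ) {c : ℕ} {q : Fin c → ℝ} (hq : ∀ i, |q i| < 1) :
    HasSum (gWeight b q) (∏ i, (1 - q i) ^ (-(b : ℤ))) := by
  obtain ⟨row_hasSum, row_norm⟩ := hasSum_prod_apply (f := fun k (n : ℕ) => q k ^ n)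
    (fun k => hasSum_geometric_of_abs_lt_one (hq k))
    fun k => summable_norm_geometric_of_norm_lt_one (hq k)
  have array_hasSum := (hasSum_prod_apply (n := b) (fun _ => row_hasSum) fun _ => row_norm).1
  rw [← (PP.descentCountEquiv b c).hasSum_iff] at array_hasSum
  have value : ∏ i, (1 - q i) ^ (-(b : ℤ)) = ∏ _i : Fin b, ∏ k, (1 - q k)⁻¹ := by
    simp [Finset.prod_pow]
  rw [value, funext (PP.gWeight_eq_prod_descentCount q)]
  exact array_hasSum

/-! ### The symbol of the Toeplitz matrix -/

theorem prod_one_add_smul_eq_sum_esymm {R A : Type*} [CommRing R] [CommRing A] [Algebra R A] {c : ℕ}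
    (q : Fin c → R) (w : A) :
    ∏ i, (1 + q i • w) = ∑ l ∈ Finset.range (c + 1),
      MvPolynomial.eval q (MvPolynomial.esymm (Fin c) R l) • w ^ l := by
  rw [Finset.prod_one_add, Finset.sum_powerset, Finset.card_univ, Fintype.card_fin]
  refine Finset.sum_congr rfl fun l _ => ?_
  rw [MvPolynomial.esymm, map_sum, Finset.sum_smul]
  refine Finset.sum_congr rfl fun t ht => ?_
  rw [Finset.prod_smul, Finset.prod_const, (Finset.mem_powersetCard.1 ht).2]
  simp

theorem intChoose_natCast (b m : ℕ) : intChoose b m = b.choose m := by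
  simp [intChoose]

theorem intChoose_of_neg (b : ℕ) {m : ℤ} (hm : m < 0) : intChoose b m = 0 :=
  if_neg hm.not_ge

section Toeplitz

open PowerSeries

theorem coeff_X_pow_mul_one_add_X_pow {R : Type*} [CommRing R] (b j m : ℕ) :
    coeff (b + j) (X ^ m * (1 + X) ^ b : R⟦X⟧) = intChoose b ((m : ℤ) - j) := by
  rw [coeff_X_pow_mul', coeff_one_add_X_pow]
  rcases lt_or_ge m j with hmj | hjm
  · rw [intChoose_of_neg b (by omega), if_pos (by omega), Nat.choose_eq_zero_of_lt (by omega)]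
  obtain ⟨t, rfl⟩ := Nat.exists_eq_add_of_le hjm
  rw [Nat.cast_add, add_sub_cancel_left, intChoose_natCast]
  rcases le_or_gt t b with htb | hbt
  · rw [if_pos (by omega), show b + j - (j + t) = b - t by omega, Nat.choose_symm htb]
  · rw [if_neg (by omega), Nat.choose_eq_zero_of_lt hbt, Nat.cast_zero]

theorem jacobiTrudiRow_eq_phiHat (a b : ℕ) {c : ℕ} (q : Fin c → ℝ) :
    (fun i : Fin a => jacobiTrudiRow a i b ((∏ k, (1 + q k • X)) * (1 + X) ^ b)) =
      Matrix.of fun i j : Fin a => phiHat b q ((i : ℤ) - (j : ℤ)) := by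
  funext i j
  rw [jacobiTrudiRow_apply, prod_one_add_smul_eq_sum_esymm, Matrix.of_apply, phiHat, Finset.sum_mul,
    Finset.mul_sum, map_sum]
  refine Finset.sum_congr rfl fun l _ => ?_
  rw [smul_mul_assoc, mul_smul_comm, coeff_smul, smul_eq_mul, mul_comm, ← mul_assoc, ← pow_add,
    coeff_X_pow_mul_one_add_X_pow, Nat.cast_add, add_sub_assoc, add_sub_left_comm]

end Toeplitz

theorem hasSum_intChoose_mul_zpow (b : ℕ) (z : ℂ) :
    HasSum (fun m : ℤ => (intChoose b m : ℂ) * z ^ m) ((1 + z) ^ b) := by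
  have binomial : HasSum (fun m : ℕ => (b.choose m : ℂ) * z ^ m) ((1 + z) ^ b) := by
    rw [add_comm, add_pow]
    simp only [one_pow, mul_one, mul_comm]
    refine hasSum_sum_of_ne_finset_zero fun m hm => ?_
    rw [Nat.choose_eq_zero_of_lt (by simpa using hm), Nat.cast_zero, mul_zero]
  have eq_zero_of_neg : ∀ m ∉ Set.range ((↑) : ℕ → ℤ), (intChoose b m : ℂ) * z ^ m = 0 := by
    intro m hm
    have neg : m < 0 := not_le.1 fun h => hm ⟨m.toNat, Int.toNat_of_nonneg h⟩
    rw [intChoose_of_neg b neg, Nat.cast_zero, zero_mul]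
  rw [← (Nat.cast_injective (R := ℤ)).hasSum_iff eq_zero_of_neg]
  simpa only [Function.comp_def, intChoose_natCast, zpow_natCast] using binomial

theorem hasSum_phiHat_mul_zpow (b : ℕ) {c : ℕ} (q : Fin c → ℝ) {z : ℂ} (hz : z ≠ 0) :
    HasSum (fun k : ℤ => (phiHat b q k : ℂ) * z ^ k)
      ((1 + z) ^ b * ∏ i, (1 + (q i : ℂ) * z⁻¹)) := by
  let e (l : ℕ) : ℝ := MvPolynomial.eval q (MvPolynomial.esymm (Fin c) ℝ l)
  have symbol : ∏ i, (1 + (q i : ℂ) * z⁻¹) = ∑ l ∈ Finset.range (c + 1), (e l : ℂ) * z⁻¹ ^ l := by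
    simpa only [Complex.real_smul] using prod_one_add_smul_eq_sum_esymm q z⁻¹
  have shifted : ∀ l : ℕ, HasSum (fun k : ℤ => (intChoose b (l + k) : ℂ) * e l * z ^ k)
      ((1 + z) ^ b * (e l * z⁻¹ ^ l)) := by
    intro l
    refine (((Equiv.addLeft (l : ℤ)).hasSum_iff.2 (hasSum_intChoose_mul_zpow b z)).mul_right
      (e l * z⁻¹ ^ l)).congr_fun fun k => ?_
    rw [Function.comp_apply, Equiv.coe_addLeft, zpow_add₀ hz, zpow_natCast, inv_pow]
    field_simp
  rw [symbol, Finset.mul_sum]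
  refine (hasSum_sum fun l _ => shifted l).congr_fun fun k => ?_
  simp [phiHat, e, Finset.sum_mul]

/-! ### The `g`-measure -/

section Measure

variable (b : ℕ) {c : ℕ} {q : Fin c → ℝ}

theorem gWeight_nonneg (hq : ∀ i, 0 ≤ q i) (π : PP b c) : 0 ≤ gWeight b q π :=
  Finset.prod_nonneg fun p _ => hq (π.level p)

theorem gZ_nonneg (hq : ∀ i, 0 ≤ q i) : 0 ≤ gZ b q :=
  tsum_nonneg (gWeight_nonneg b hq)

theorem gMeasure_apply_of_hasSum (hq : ∀ i, 0 ≤ q i) {A : Set (PP b c)} {s : ℝ}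
    (hs : HasSum (fun π : A => gWeight b q π) s) :
    gMeasure b q A = ENNReal.ofReal (s / gZ b q) := by
  have density_nonneg : ∀ π : A, 0 ≤ gWeight b q π / gZ b q := fun π =>
    div_nonneg (gWeight_nonneg b hq π) (gZ_nonneg b hq)
  have density_hasSum := hs.div_const (gZ b q)
  have hA : MeasurableSet A := MeasurableSpace.measurableSet_top
  rw [← density_hasSum.tsum_eq, ENNReal.ofReal_tsum_of_nonneg density_nonneg
    density_hasSum.summable, gMeasure, Measure.sum_apply _ hA,
    tsum_subtype A fun π => ENNReal.ofReal (gWeight b q π / gZ b q)]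
  refine tsum_congr fun π => ?_
  rw [Measure.smul_apply, Measure.dirac_apply' _ hA, smul_eq_mul]
  by_cases hπ : π ∈ A <;> simp [hπ]

theorem gMeasure_real_of_hasSum (hq : ∀ i, 0 ≤ q i) {A : Set (PP b c)} {s : ℝ}
    (hs : HasSum (fun π : A => gWeight b q π) s) : (gMeasure b q).real A = s / gZ b q := by
  rw [measureReal_def, gMeasure_apply_of_hasSum b hq hs, ENNReal.toReal_ofReal]
  have weight_nonneg : ∀ π : A, 0 ≤ gWeight b q π := fun π => gWeight_nonneg b hq π
  exact div_nonneg (HasSum.nonneg weight_nonneg hs) (gZ_nonneg b hq)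

theorem isProbabilityMeasure_gMeasure (hq : ∀ i, 0 ≤ q i) (hsum : Summable (gWeight b q))
    (hZ : gZ b q ≠ 0) : IsProbabilityMeasure (gMeasure b q) where
  measure_univ := by
    have univ_hasSum : HasSum (fun π : (Set.univ : Set (PP b c)) => gWeight b q π) (gZ b q) :=
      ((Equiv.Set.univ (PP b c)).hasSum_iff (f := gWeight b q)).2 hsum.hasSum
    rw [gMeasure_apply_of_hasSum b hq univ_hasSum, div_self hZ, ENNReal.ofReal_one]

theorem gMeasure_real_lambda1_le (hq : ∀ i, 0 ≤ q i) (a : ℕ) :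
    (gMeasure b q).real {π | π.lambda1 ≤ a} =
      (Matrix.of fun i j : Fin a => phiHat b q ((i : ℤ) - (j : ℤ))).det / gZ b q := by
  have lambda1_hasSum := hasSum_fintype fun π : {π : PP b c // π.lambda1 ≤ a} => gWeight b q π.1
  rw [PP.sum_gWeight_lambda1_le, jacobiTrudiRow_eq_phiHat] at lambda1_hasSum
  exact gMeasure_real_of_hasSum b hq lambda1_hasSum

end Measure

theorem gZ_eq (b : ℕ) {c : ℕ} {q : Fin c → ℝ} (hq : ∀ i, |q i| < 1) :
    gZ b q = ∏ i, (1 - q i) ^ (-(b : ℤ)) :=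
  (hasSum_gWeight b hq).tsum_eq

theorem gZ_ne_zero (b : ℕ) {c : ℕ} {q : Fin c → ℝ} (hq : ∀ i, |q i| < 1) : gZ b q ≠ 0 := by
  rw [gZ_eq b hq]
  exact Finset.prod_ne_zero_iff.2 fun i _ => zpow_ne_zero _ (sub_pos.2 (abs_lt.1 (hq i)).2).ne'

theorem eval_schurPoly_rectDiagram_append_one (a b : ℕ) {c : ℕ} (q : Fin c → ℝ) :
    MvPolynomial.eval (Fin.append (fun _ : Fin b => (1 : ℝ)) q)
        (schurPoly (rectDiagram a b) (b + c)) =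
      (Matrix.of fun i j : Fin a => phiHat b q ((i : ℤ) - (j : ℤ))).det := by
  rw [eval_schurPoly_rectDiagram, ← jacobiTrudiRow_eq_phiHat, Fin.prod_univ_add]
  simp [mul_comm]

theorem theorem6p3 (b c : ℕ) (q : Fin c → ℝ) (hq : ∀ i, q i ∈ Set.Ioo (0 : ℝ) 1) :
    -- the `g`-measure is well defined, with the explicit normalization constant
    Summable (gWeight b q) ∧
    gZ b q = ∏ i, (1 - q i) ^ (-(b : ℤ)) ∧
    MeasureTheory.IsProbabilityMeasure (gMeasure b q) ∧
    -- the distribution function of the first row length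
    (∀ a : ℕ, (gMeasure b q).real {π | π.lambda1 ≤ a} =
      MvPolynomial.eval (Fin.append (fun _ : Fin b => (1 : ℝ)) q)
        (schurPoly (rectDiagram a b) (b + c)) / gZ b q) ∧
    -- its Toeplitz determinant expression
    (∀ a : ℕ, (gMeasure b q).real {π | π.lambda1 ≤ a} =
      (Matrix.of fun i j : Fin a => phiHat b q ((i : ℤ) - (j : ℤ))).det / gZ b q) ∧
    -- the symbol of the Toeplitz matrix
    (∀ z : ℂ, z ≠ 0 → HasSum (fun k : ℤ => (phiHat b q k : ℂ) * z ^ k)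
      ((1 + z) ^ b * ∏ i, (1 + (q i : ℂ) * z⁻¹))) := by
  have hq_nonneg : ∀ i, 0 ≤ q i := fun i => (hq i).1.le
  have hq_abs : ∀ i, |q i| < 1 := fun i => by
    rw [abs_of_nonneg (hq_nonneg i)]
    exact (hq i).2
  have hsum := (hasSum_gWeight b hq_abs).summable
  refine ⟨hsum, gZ_eq b hq_abs,
    isProbabilityMeasure_gMeasure b hq_nonneg hsum (gZ_ne_zero b hq_abs), fun a => ?_,
    gMeasure_real_lambda1_le b hq_nonneg, fun z hz => hasSum_phiHat_mul_zpow b q hz⟩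
  rw [gMeasure_real_lambda1_le b hq_nonneg, eval_schurPoly_rectDiagram_append_one]
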